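/- Conventions. A valued field $(K,v)$ is a field $K$ together with a valuation $v$ whose valuation ring $\mathcal O_v$ is a proper subring of $K$; $\mathcal M_v$ is its maximal ideal. The valuation $w$ of a valued field $(L,w)$ is of rank $1$ if its value group has exactly one proper convex subgroup, namely $\{0\}$. The Macintyre language $\mathcal L_{Mac}$ consists of the language of rings $\{+,-,\cdot,0,1\}$, a unary predicate $\mathcal O$, and unary predicates $P_n$ for all $n>1$; a valued field is an $\mathcal L_{Mac}$-structure by interpreting $\mathcal O$ as its valuation ring and $P_n$ as the set of nonzero $n$-th powers. A complete theory admits QE in $\mathcal L_{Mac}$ if modulo it every $\mathcal L_{Mac}$-formula is equivalent to a quantifier-free $\mathcal L_{Mac}$-formula in the same free variables. Elements $r,t\in\mathcal O_v$ are comparable if for some integer $n\ge 1$ either $v(r^n)\le v(t)\le v(r^{n+1})$ or $v(t^n)\le v(r)\le v(t^{n+1})$; write $r\ll t$ if $r,t$ are not comparable and $v(r)<v(t)$. The valued field $(K,v)$ is of prohenselian degree $n$ if for every $1\le m\le n$ and all nonzero $t_1,\dots,t_m\in\mathcal M_v$ with $t_1\ll\dots\ll t_m$, the following holds. Let $F$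 be the relative algebraic closure in $K$ of the subfield generated by $t_1,\dots,t_m$. Then there is a henselian valuation ring of $F$, different from $F$, that contains $F\cap\mathcal O_v$. Theorem. Let $(K,v)$ be a valued field of residue characteristic $0$ and of prohenselian degree $2$ such that the complete $\mathcal L_{Mac}$-theory $\mathrm{Th}(K,v)$ admits QE in $\mathcal L_{Mac}$. Then there is a valued field $(L,w)$ such that $w$ is of rank $1$, $(L,w)\equiv(K,v)$ as $\mathcal L_{Mac}$-structures, and $(L,w)$ omits the type $\{0<v(X^n)<v(Y)\wedge Y\neq 0 : n\ge 1\}$. -/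

import Mathlib

open FirstOrder

namespace MacintyreVal

/-! ### The Macintyre language -/

/-- Relation symbols of the Macintyre language: a unary predicate for the valuation ring and
unary predicates `P_n` for all `n > 1`. -/
inductive MacRel : ℕ → Type
  | valRing : MacRel 1
  | pow (n : ℕ) (hn : 1 < n) : MacRel 1

/-- The Macintyre language: the language of rings `{+, *, -, 0, 1}` together with `MacRel`. -/
def macLang : FirstOrder.Language where
  Functions := FirstOrder.ringFunc
  Relations := MacRel

/-- A valued field, given by a field `K` and a valuation ring `A` of `K`, as a structure of the
Macintyre language. `P_n` is interpreted as the set of nonzero `n`-th powers of `K`. -/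
@[reducible]
def macStructure {K : Type*} [Field K] (A : ValuationSubring K) : macLang.Structure K where
  funMap := fun f =>
    match f with
    | ringFunc.add => fun x => x 0 + x 1
    | ringFunc.mul => fun x => x 0 * x 1
    | ringFunc.neg => fun x => - x 0
    | ringFunc.zero => fun _ => 0
    | ringFunc.one => fun _ => 1
  RelMap := fun R =>
    match R with
    | MacRel.valRing => fun x => x 0 ∈ A
    | MacRel.pow n _ => fun x => x 0 ≠ 0 ∧ ∃ y : K, x 0 = y ^ n

/-- The complete theory of the valued field `(K, A)` in the Macintyre language. -/
def macTheory {K : Type*} [Field K] (A : ValuationSubring K) : macLang.Theory :=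
  letI := macStructure A
  macLang.completeTheory K

/-- Elementary equivalence of valued fields in the Macintyre language. -/
def MacEquiv {K L : Type*} [Field K] [Field L] (A : ValuationSubring K)
    (B : ValuationSubring L) : Prop :=
  macTheory A = macTheory B

/-- A theory admits quantifier elimination: modulo the theory every formula is equivalent to a
quantifier-free formula in the same free variables. -/
def AdmitsQE {𝓛 : FirstOrder.Language} (T : 𝓛.Theory) : Prop :=
  ∀ (n : ℕ) (φ : 𝓛.Formula (Fin n)), ∃ ψ : 𝓛.Formula (Fin n),
    FirstOrder.Language.BoundedFormula.IsQF ψ ∧ φ ⇔[T] ψ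

/-! ### Rank of an ordered group -/

/-- A subgroup `H` of a (multiplicatively written) ordered abelian group is convex. -/
def IsConvexSubgroup {G : Type*} [CommGroup G] [LinearOrder G] (H : Subgroup G) : Prop :=
  ∀ a b : G, b ∈ H → 1 ≤ a → a ≤ b → a ∈ H

/-- An ordered abelian group has rank one: the trivial subgroup is proper and it is the only proper
convex subgroup. -/
def GroupRankOne (G : Type*) [CommGroup G] [LinearOrder G] : Prop :=
  ∀ H : Subgroup G, (IsConvexSubgroup H ∧ H ≠ ⊤) ↔ H = ⊥

/-- The valuation with valuation ring `A` is of rank one. -/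
def RankOne {K : Type*} [Field K] (A : ValuationSubring K) : Prop :=
  GroupRankOne (A.ValueGroup)ˣ

/-! ### Comparability and prohenselian degree

Mathlib writes valuations multiplicatively with the order reversed: for the additive valuation `v`
with valuation ring `A`, the inequality `v a ≤ v b` is `A.valuation b ≤ A.valuation a`, and
`0 < v a` is `A.valuation a < 1`. -/

/-- `r` and `t` are comparable: for some `n ≥ 1`, `v (r ^ n) ≤ v t ≤ v (r ^ (n + 1))` or
`v (t ^ n) ≤ v r ≤ v (t ^ (n + 1))`. (The value `n = 0` has to be left out, because it would make
any two elements of `A` comparable.) -/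
def Comparable {K : Type*} [Field K] (A : ValuationSubring K) (r t : K) : Prop :=
  ∃ n : ℕ, 1 ≤ n ∧
    ((A.valuation (r ^ (n + 1)) ≤ A.valuation t ∧ A.valuation t ≤ A.valuation (r ^ n)) ∨
      (A.valuation (t ^ (n + 1)) ≤ A.valuation r ∧ A.valuation r ≤ A.valuation (t ^ n)))

/-- `r ≪ t`: the elements `r` and `t` are incomparable and `v r < v t`. -/
def MuchSmaller {K : Type*} [Field K] (A : ValuationSubring K) (r t : K) : Prop :=
  ¬ Comparable A r t ∧ A.valuation t < A.valuation r

/-- The relative algebraic closure in `K` of the subfield generated by a set `S`. -/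
abbrev relAlgClosure {K : Type*} [Field K] (S : Set K) :
    IntermediateField (Subfield.closure S) K :=
  algebraicClosure (Subfield.closure S) K

/-- The valuation ring `B` of `F` admits a henselian coarsening: it is contained in a henselian
valuation ring of `F`. As valuation rings are proper subrings here, the trivial one is excluded. -/
def HasHenselianCoarsening {F : Type*} [Field F] (B : ValuationSubring F) : Prop :=
  ∃ C : ValuationSubring F, B ≤ C ∧ C ≠ ⊤ ∧ HenselianLocalRing C

/-- `(K, A)` is of prohenselian degree `n`: for all `1 ≤ m ≤ n` and all nonzero elements
`t₁ ≪ ⋯ ≪ t_m` of the maximal ideal of `A`, the restriction of `A` to the algebraic closure of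
`ℚ(t₁, …, t_m)` in `K` admits a henselian coarsening. -/
def ProhenselianOfDegree {K : Type*} [Field K] (A : ValuationSubring K) (n : ℕ) : Prop :=
  ∀ m : ℕ, 1 ≤ m → m ≤ n → ∀ t : Fin m → K,
    (∀ i, t i ≠ 0 ∧ A.valuation (t i) < 1) →
    (∀ i j, i < j → MuchSmaller A (t i) (t j)) →
    HasHenselianCoarsening (A.comap (algebraMap (relAlgClosure (Set.range t)) K))

/-! ### The type to be omitted -/

/-- The pair `(x, y)` realizes the type `{0 < v (X ^ n) < v Y ∧ Y ≠ 0 : n ≥ 1}`. -/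
def RealizesGapType {K : Type*} [Field K] (A : ValuationSubring K) (x y : K) : Prop :=
  ∀ n : ℕ, 1 ≤ n →
    A.valuation (x ^ n) < 1 ∧ A.valuation y < A.valuation (x ^ n) ∧ y ≠ 0

end MacintyreVal

/-! Write `v` additively. A rank-one model is obtained by omitting types: if no pair `(x, y)` has
all positive multiples of `v x > 0` below `v y` with `y ≠ 0`, then a nontrivial value group is
archimedean. It must therefore be shown that no formula isolates the gap type. By quantifier
elimination, an isolating formula may be taken quantifier-free, so it only speaks about integer
polynomials in `x` and `y`. Suppose `(x, y)` realizes the gap type. A nonzero polynomial `p` has a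
dominant monomial `a * X ^ i * Y ^ j`, with `a` a nonzero integer, and `p (x, y)` is this monomial
times two one-units. The first has the form `1 + x * s(x) / a`; the second differs from `1` by an
element of value at least `v y / 2`. Henselian coarsenings on the relative algebraic closures
generated by `x` and by `x, y` make these one-units `m`-th powers
(`HasHenselianCoarsening.exists_pow_eq`). The point is that the powers of the generator of largest
value are cofinal in the value group of such a closure, so that this generator is a non-unit in
every proper coarsening. Replace `(x, y)` by `(x * y ^ m, y ^ (1 + m * N))`. For large `N` the same
monomial dominates, and it changes by an `m`-th power (`exists_evalPair_perturb`). If `m` is a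
multiple of all exponents of the power predicates in the formula, its truth value is unchanged, but
the new pair is comparable and does not realize the gap type. The omitting types theorem is proved
by choosing a generic ultrafilter on the sequences in `K`. In the corresponding ultrapower, the
germs of the coordinate functions form a countable model that omits the type. -/

namespace FirstOrder.Language

/-! ### Generic ultrafilters on sequences and omitting types -/

variable {L : Language}

/-- The value of a term depends on finitely many of its variables. -/
theorem Term.exists_bound_realize {γ : Type*} (t : L.Term (ℕ ⊕ γ)) (M : Type*) [L.Structure M] :
    ∃ N, ∀ (f g : ℕ → M) (xs : γ → M), (∀ i < N, f i = g i) →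
      t.realize (Sum.elim f xs) = t.realize (Sum.elim g xs) := by
  induction t with
  | var a =>
    rcases a with a | a
    · exact ⟨a + 1, fun f g xs h => by simpa using h a (Nat.lt_succ_self a)⟩
    · exact ⟨0, fun f g xs h => by simp⟩
  | @func l F ts ih =>
    choose N hN using ih
    refine ⟨Finset.univ.sup N, fun f g xs h => ?_⟩
    simp only [Term.realize]
    congr 1
    ext k
    exact hN k f g xs fun i hi => h i (hi.trans_le (Finset.le_sup (Finset.mem_univ k)))

/-- The truth value of a formula depends on finitely many of its variables. -/
theorem BoundedFormula.exists_bound_realize {n : ℕ} (φ : L.BoundedFormula ℕ n) (M : Type*)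
    [L.Structure M] : ∃ N, ∀ (f g : ℕ → M) (xs : Fin n → M), (∀ i < N, f i = g i) →
      (φ.Realize f xs ↔ φ.Realize g xs) := by
  induction φ with
  | falsum => exact ⟨0, fun f g xs h => Iff.rfl⟩
  | equal t₁ t₂ =>
    obtain ⟨N₁, h₁⟩ := t₁.exists_bound_realize M
    obtain ⟨N₂, h₂⟩ := t₂.exists_bound_realize M
    refine ⟨max N₁ N₂, fun f g xs h => ?_⟩
    simp only [BoundedFormula.Realize]
    rw [h₁ f g xs fun i hi => h i (lt_max_of_lt_left hi),
      h₂ f g xs fun i hi => h i (lt_max_of_lt_right hi)]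
  | rel R ts =>
    choose N hN using fun k => (ts k).exists_bound_realize M
    refine ⟨Finset.univ.sup N, fun f g xs h => ?_⟩
    simp only [BoundedFormula.Realize]
    have : (fun k => (ts k).realize (Sum.elim f xs)) = fun k => (ts k).realize (Sum.elim g xs) := by
      ext k
      exact hN k f g xs fun i hi => h i (hi.trans_le (Finset.le_sup (Finset.mem_univ k)))
    rw [this]
  | imp φ ψ ihφ ihψ =>
    obtain ⟨N₁, h₁⟩ := ihφ
    obtain ⟨N₂, h₂⟩ := ihψ
    refine ⟨max N₁ N₂, fun f g xs h => ?_⟩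
    simp only [BoundedFormula.Realize]
    rw [h₁ f g xs fun i hi => h i (lt_max_of_lt_left hi),
      h₂ f g xs fun i hi => h i (lt_max_of_lt_right hi)]
  | all φ ih =>
    obtain ⟨N, hN⟩ := ih
    refine ⟨N, fun f g xs h => ?_⟩
    simp only [BoundedFormula.Realize]
    exact forall_congr' fun y => hN f g _ h

/-- The formula obtained by naming the variables of a formula by natural numbers. -/
def BoundedFormula.nameVars {n : ℕ} (φ : L.BoundedFormula Empty n) (xs : Fin n → ℕ) :
    L.Formula ℕ :=
  φ.toFormula.relabel (Sum.elim Empty.elim xs)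

theorem BoundedFormula.realize_nameVars {n : ℕ} (φ : L.BoundedFormula Empty n) (xs : Fin n → ℕ)
    {M : Type*} [L.Structure M] (f : ℕ → M) :
    (φ.nameVars xs).Realize f ↔ φ.Realize default (f ∘ xs) := by
  rw [nameVars, Formula.realize_relabel, BoundedFormula.realize_toFormula]
  exact iff_of_eq (congrArg₂ _ (Subsingleton.elim _ _) rfl)

/-- A countable family of dense sets of conditions has a generic ultrafilter. -/
theorem exists_generic_ultrafilter {X ι : Type*} [Countable ι] (C : Set (Set X))
    (hC : C.Nonempty) (hne : ∀ s ∈ C, s.Nonempty) (D : ι → Set (Set X))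
    (hD : ∀ i, ∀ s ∈ C, ∃ t ∈ C, t ⊆ s ∧ t ∈ D i) :
    ∃ U : Ultrafilter X, ∀ i, ∃ t ∈ D i, t ∈ U := by
  have := Encodable.ofCountable ι
  obtain ⟨s₀, hs₀⟩ := hC
  -- In the dual order dense families become cofinal, so an increasing sequence meeting all of them
  -- is a decreasing sequence of sets, which generates a proper filter.
  let 𝒟 : ι → Order.Cofinal (C)ᵒᵈ := fun i =>
    ⟨{t | (OrderDual.ofDual t).1 ∈ D i}, fun s => by
      obtain ⟨t, htC, hts, htD⟩ := hD i (OrderDual.ofDual s).1 (OrderDual.ofDual s).2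
      exact ⟨OrderDual.toDual ⟨t, htC⟩, htD, hts⟩⟩
  let u : ℕ → (C)ᵒᵈ := Order.sequenceOfCofinals (OrderDual.toDual ⟨s₀, hs₀⟩) 𝒟
  have hu : Monotone u := Order.sequenceOfCofinals.monotone _ 𝒟
  let F : Filter X := ⨅ n, Filter.principal (OrderDual.ofDual (u n)).1
  have hF : F.NeBot := by
    have : Nonempty X := (hne s₀ hs₀).to_type
    refine Filter.iInf_neBot_of_directed (directed_of_isDirected_le ?_) fun n => ?_
    · intro m n hmn
      exact Filter.principal_mono.2 (hu hmn)
    · exact Filter.principal_neBot_iff.2 (hne _ (OrderDual.ofDual (u n)).2)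
  refine ⟨Ultrafilter.of F, fun i => ⟨(OrderDual.ofDual (u (Encodable.encode i + 1))).1,
    Order.sequenceOfCofinals.encode_mem _ 𝒟 i, Ultrafilter.of_le F ?_⟩⟩
  exact Filter.mem_iInf_of_mem (Encodable.encode i + 1) (Filter.mem_principal_self _)

/-- The projection of a definable set of sequences to two coordinates is definable. -/
theorem Formula.exists_formula_pair {M : Type*} [L.Structure M] (ψ : L.Formula ℕ)
    (i j : ℕ) : ∃ θ : L.Formula (Fin 2), ∀ v : Fin 2 → M,
      θ.Realize v ↔ ∃ f : ℕ → M, ψ.Realize f ∧ v = ![f i, f j] := by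
  obtain ⟨N₀, hN₀⟩ := ψ.exists_bound_realize M
  let N := N₀ + i + j + 1
  -- Collapsing the variables from `N` on to `0` is harmless, since `ψ` depends only on those below
  -- `N₀`.
  let r : ℕ → Fin N := fun k => if h : k < N then ⟨k, h⟩ else ⟨0, by omega⟩
  have hr : ∀ k (h : k < N), r k = ⟨k, h⟩ := fun k h => dif_pos h
  have key : ∀ f : ℕ → M, (ψ.relabel r).Realize (fun k : Fin N => f k) ↔ ψ.Realize f := by
    intro f
    rw [Formula.realize_relabel]
    refine hN₀ _ _ _ fun k hk => ?_
    simp only [Function.comp_apply]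
    rw [hr k (by omega)]
  have hdef : (∅ : Set M).Definable L {g : Fin N → M | (ψ.relabel r).Realize g} :=
    Set.empty_definable_iff.2 ⟨ψ.relabel r, rfl⟩
  obtain ⟨θ, hθ⟩ := Set.empty_definable_iff.1 (hdef.image_comp ![r i, r j])
  refine ⟨θ, fun v => ?_⟩
  have hv : θ.Realize v ↔ v ∈ (fun g : Fin N → M => g ∘ ![r i, r j]) ''
      {g : Fin N → M | (ψ.relabel r).Realize g} := by
    rw [hθ]; rfl
  rw [hv]
  constructor
  · rintro ⟨g, hg, rfl⟩
    refine ⟨g ∘ r, ?_, ?_⟩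
    · simpa [Formula.realize_relabel] using hg
    · ext k
      fin_cases k <;> rfl
  · rintro ⟨f, hf, rfl⟩
    refine ⟨fun k => f k, (key f).2 hf, ?_⟩
    ext k
    fin_cases k
    · simp [hr i (by omega)]
    · simp [hr j (by omega)]

/-- If no formula isolates the set of formulas `σ k`, then there is an ultrafilter on the sequences
of elements of `M` for which the coordinate sequences form a Henkin family
omitting the `σ k`. -/
theorem exists_omitting_ultrafilter [Countable L.Symbols] (M : Type*) [L.Structure M] [Nonempty M]
    {κ : Type*} (σ : κ → L.Formula (Fin 2))
    (hσ : ∀ (θ : L.Formula (Fin 2)) (v : Fin 2 → M), θ.Realize v →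
      ∃ w : Fin 2 → M, θ.Realize w ∧ ∃ k, ¬ (σ k).Realize w) :
    ∃ U : Ultrafilter (ℕ → M),
      (∀ (n : ℕ) (φ : L.BoundedFormula Empty (n + 1)) (xs : Fin n → ℕ), ∃ i, ∀ᶠ f in (U : Filter (ℕ → M)),
        (∃ y, φ.Realize default (Fin.snoc (f ∘ xs) y)) →
          φ.Realize default (Fin.snoc (f ∘ xs) (f i))) ∧
      ∀ i j, ∃ k, ∀ᶠ f in (U : Filter (ℕ → M)), ¬ (σ k).Realize ![f i, f j] := by
  let C : Set (Set (ℕ → M)) := {s | s.Nonempty ∧ ∃ ψ : L.Formula ℕ, s = {f | ψ.Realize f}}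
  let D : (Σ n, L.BoundedFormula Empty n × (Fin n → ℕ)) ⊕ (ℕ × ℕ) → Set (Set (ℕ → M)) :=
    Sum.elim
      -- The last entry `z` is a dummy: it lets the requirements be indexed by a countable type that
      -- pairs a formula with as many indices as it has variables.
      (fun q => {s | ∀ (n : ℕ) (φ : L.BoundedFormula Empty (n + 1)) (xs : Fin n → ℕ) (z : ℕ),
        q = ⟨n + 1, φ, Fin.snoc xs z⟩ → ∃ i, ∀ f ∈ s,
          (∃ y, φ.Realize default (Fin.snoc (f ∘ xs) y)) →
            φ.Realize default (Fin.snoc (f ∘ xs) (f i))})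
      (fun q => {s | ∃ k, ∀ f ∈ s, ¬ (σ k).Realize ![f q.1, f q.2]})
  have : ∀ n, Countable (L.BoundedFormula Empty n) := fun n =>
    Function.Injective.countable (f := fun φ : L.BoundedFormula Empty n =>
      (⟨n, φ⟩ : Σ n, L.BoundedFormula Empty n)) sigma_mk_injective
  obtain ⟨U, hU⟩ := exists_generic_ultrafilter C
    ⟨_, Set.univ_nonempty, ⊤, by simp⟩ (fun s hs => hs.1) D (by
    rintro (⟨n, φ, xs⟩ | ⟨i, j⟩) s ⟨⟨f₀, hf₀⟩, ψ, rfl⟩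
    · cases n with
      | zero => exact ⟨_, ⟨⟨f₀, hf₀⟩, ψ, rfl⟩, subset_rfl, fun n φ xs z h => by simp at h⟩
      | succ n =>
        obtain ⟨N, hN⟩ := ψ.exists_bound_realize M
        -- A fresh variable: changing coordinate `i` affects neither `ψ` nor the parameters, so it
        -- can be set to a witness.
        let i := N + Finset.univ.sup xs + 1
        have hi : ∀ k, xs k < i := fun k => by
          have := Finset.le_sup (f := xs) (Finset.mem_univ k)
          omega
        let ys : Fin n → ℕ := fun k => xs k.castSucc
        let χ : L.Formula ℕ := (BoundedFormula.nameVars φ.ex ys).imp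
          (BoundedFormula.nameVars φ (Fin.snoc ys i))
        have hχ : ∀ f : ℕ → M, χ.Realize f ↔ ((∃ y, φ.Realize default (Fin.snoc (f ∘ ys) y)) →
            φ.Realize default (Fin.snoc (f ∘ ys) (f i))) := by
          intro f
          simp only [χ, Formula.realize_imp, BoundedFormula.realize_nameVars,
            BoundedFormula.realize_ex, Fin.comp_snoc]
        refine ⟨{f | (ψ ⊓ χ).Realize f}, ⟨?_, _, rfl⟩, fun f hf => (Formula.realize_inf.1 hf).1, ?_⟩
        · by_cases h : ∃ y, φ.Realize default (Fin.snoc (f₀ ∘ ys) y)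
          · obtain ⟨y, hy⟩ := h
            refine ⟨Function.update f₀ i y, Formula.realize_inf.2 ⟨?_, (hχ _).2 fun _ => ?_⟩⟩
            · refine (hN _ _ _ fun k hk => ?_).1 hf₀
              rw [Function.update_of_ne (by omega)]
            · have : Function.update f₀ i y ∘ ys = f₀ ∘ ys := by
                ext k
                simp only [Function.comp_apply]
                rw [Function.update_of_ne (hi _).ne]
              rw [this, Function.update_self]
              exact hy
          · exact ⟨f₀, Formula.realize_inf.2 ⟨hf₀, (hχ _).2 fun h' => absurd h' h⟩⟩
        · intro n' φ' xs' z h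
          obtain ⟨h1, h2⟩ := Sigma.mk.inj_iff.1 h
          obtain rfl : n = n' := by omega
          obtain ⟨rfl, h3⟩ := Prod.mk_inj.1 (eq_of_heq h2)
          have : xs' = ys := by
            ext k
            simp [ys, h3]
          subst this
          exact ⟨i, fun f hf => (hχ f).1 (Formula.realize_inf.1 hf).2⟩
    -- The projection of the condition to coordinates `i, j` is definable, so it does not isolate
    -- the type. A point of it violating some `σ k` lifts to a sequence in the condition.
    · obtain ⟨θ, hθ⟩ := ψ.exists_formula_pair (M := M) i j
      obtain ⟨w, hw, k, hk⟩ := hσ θ _ ((hθ _).2 ⟨f₀, hf₀, rfl⟩)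
      obtain ⟨f, hf, rfl⟩ := (hθ w).1 hw
      have hreal : ∀ g : ℕ → M, ((σ k).relabel ![i, j]).Realize g ↔ (σ k).Realize ![g i, g j] := by
        intro g
        rw [Formula.realize_relabel]
        have : g ∘ ![i, j] = ![g i, g j] := by
          ext k
          fin_cases k <;> rfl
        rw [this]
      refine ⟨{g | (ψ ⊓ ((σ k).relabel ![i, j]).not).Realize g}, ⟨⟨f, ?_⟩, _, rfl⟩,
        fun g hg => (Formula.realize_inf.1 hg).1, k, fun g hg => ?_⟩
      · refine Formula.realize_inf.2 ⟨hf, Formula.realize_not.2 ?_⟩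
        rwa [hreal]
      · rw [← hreal]
        exact Formula.realize_not.1 (Formula.realize_inf.1 hg).2)
  refine ⟨U, fun n φ xs => ?_, fun i j => ?_⟩
  · obtain ⟨t, ht, htU⟩ := hU (Sum.inl ⟨n + 1, φ, Fin.snoc xs 0⟩)
    obtain ⟨i, hi⟩ := ht n φ xs 0 rfl
    exact ⟨i, Filter.mem_of_superset htU hi⟩
  · obtain ⟨t, ⟨k, hk⟩, htU⟩ := hU (Sum.inr (i, j))
    exact ⟨k, Filter.mem_of_superset htU hk⟩

end FirstOrder.Language

/-! ### The Henkin subfield of an ultrapower -/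

namespace MacintyreVal

open FirstOrder.Language Filter

instance : Countable macLang.Symbols := by
  have h₁ : Countable (Σ l, macLang.Functions l) := by
    refine Function.Injective.countable (β := ℕ) (f := fun x => match x with
      | ⟨_, ringFunc.add⟩ => 0
      | ⟨_, ringFunc.mul⟩ => 1
      | ⟨_, ringFunc.neg⟩ => 2
      | ⟨_, ringFunc.zero⟩ => 3
      | ⟨_, ringFunc.one⟩ => 4) ?_
    rintro ⟨_, _ | _⟩ ⟨_, _ | _⟩ h <;> simp_all
  have h₂ : Countable (Σ l, macLang.Relations l) := by
    refine Function.Injective.countable (β := ℕ) (f := fun x => match x with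
      | ⟨_, MacRel.valRing⟩ => 0
      | ⟨_, MacRel.pow n _⟩ => n) ?_
    rintro ⟨_, _ | ⟨n, hn⟩⟩ ⟨_, _ | ⟨m, hm⟩⟩ h
    · rfl
    · simp only at h; omega
    · simp only at h; omega
    · simp only at h; subst h; rfl
  exact inferInstanceAs (Countable ((Σ l, macLang.Functions l) ⊕ (Σ l, macLang.Relations l)))

section Terms

variable {γ : Type*}

/-- The sum of two terms. -/
def addTerm (s t : macLang.Term γ) : macLang.Term γ :=
  Functions.apply₂ (L := macLang) (ringFunc.add : macLang.Functions 2) s t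

/-- The product of two terms. -/
def mulTerm (s t : macLang.Term γ) : macLang.Term γ :=
  Functions.apply₂ (L := macLang) (ringFunc.mul : macLang.Functions 2) s t

/-- The negative of a term. -/
def negTerm (s : macLang.Term γ) : macLang.Term γ :=
  Functions.apply₁ (L := macLang) (ringFunc.neg : macLang.Functions 1) s

/-- The term `0`. -/
def zeroTerm : macLang.Term γ := Constants.term (L := macLang) (ringFunc.zero : macLang.Functions 0)

/-- The term `1`. -/
def oneTerm : macLang.Term γ := Constants.term (L := macLang) (ringFunc.one : macLang.Functions 0)

/-- The powers of a term. -/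
def powTerm (s : macLang.Term γ) : ℕ → macLang.Term γ
  | 0 => oneTerm
  | n + 1 => mulTerm (powTerm s n) s

variable {K : Type*} [Field K] (A : ValuationSubring K) (v : γ → K) (s t : macLang.Term γ)

theorem realize_mulTerm : letI := macStructure A
    (mulTerm s t).realize v = s.realize v * t.realize v := rfl

theorem realize_oneTerm : letI := macStructure A
    (oneTerm : macLang.Term γ).realize v = 1 := rfl

theorem realize_powTerm (n : ℕ) : letI := macStructure A
    (powTerm s n).realize v = s.realize v ^ n := by
  let _ := macStructure A
  induction n with
  | zero => rw [pow_zero]; exact realize_oneTerm A v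
  | succ n ih => rw [pow_succ, ← ih]; exact realize_mulTerm A v _ _

end Terms

variable {K : Type*} [Field K] (A : ValuationSubring K)

/-- The ultrapower of a valuation ring. -/
def germValuationSubring {X : Type*} (U : Ultrafilter X) :
    ValuationSubring (Germ (U : Filter X) K) where
  carrier := {x | x.LiftPred (· ∈ A)}
  mul_mem' := by
    rintro ⟨f⟩ ⟨g⟩ hf hg
    exact Eventually.mp hf (Eventually.mono hg fun _ hy hx => A.mul_mem _ _ hx hy)
  one_mem' := Eventually.of_forall fun _ => A.one_mem
  add_mem' := by
    rintro ⟨f⟩ ⟨g⟩ hf hg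
    exact Eventually.mp hf (Eventually.mono hg fun _ hy hx => A.add_mem _ _ hx hy)
  zero_mem' := Eventually.of_forall fun _ => A.zero_mem
  neg_mem' := by
    rintro ⟨f⟩ hf
    exact Eventually.mono hf fun _ hx => A.neg_mem _ hx
  mem_or_inv_mem' := by
    rintro ⟨f⟩
    exact Ultrafilter.eventually_or.1 (Eventually.of_forall fun x => A.mem_or_inv_mem (f x))

/-- The germ of the `i`-th coordinate. -/
def coordGerm (U : Ultrafilter (ℕ → K)) (i : ℕ) : Germ (U : Filter (ℕ → K)) K :=
  ((fun f => f i : (ℕ → K) → K) : Germ (U : Filter (ℕ → K)) K)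

/-- The coordinates form a Henkin family with respect to the ultrafilter `U`. -/
def IsHenkin (U : Ultrafilter (ℕ → K)) : Prop :=
  letI := macStructure A
  ∀ (n : ℕ) (φ : macLang.BoundedFormula Empty (n + 1)) (xs : Fin n → ℕ), ∃ i,
    ∀ᶠ f in (U : Filter (ℕ → K)), (∃ y, φ.Realize default (Fin.snoc (f ∘ xs) y)) →
      φ.Realize default (Fin.snoc (f ∘ xs) (f i))

variable {A} {U : Ultrafilter (ℕ → K)}

/-- Solvable equations have solutions among the coordinates; this gives closure under the field
operations and, later, roots inside the Henkin subfield. -/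
theorem IsHenkin.exists_eq (hU : IsHenkin A U) {n : ℕ}
    (s t : macLang.Term (Empty ⊕ Fin (n + 1))) (xs : Fin n → ℕ) : letI := macStructure A
    ∃ i, ∀ᶠ f in (U : Filter (ℕ → K)),
      (∃ y, s.realize (Sum.elim default (Fin.snoc (f ∘ xs) y)) =
        t.realize (Sum.elim default (Fin.snoc (f ∘ xs) y))) →
      s.realize (Sum.elim default (Fin.snoc (f ∘ xs) (f i))) =
        t.realize (Sum.elim default (Fin.snoc (f ∘ xs) (f i))) := by
  let _ := macStructure A
  obtain ⟨i, hi⟩ := hU n (s.bdEqual t) xs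
  refine ⟨i, ?_⟩
  simpa only [BoundedFormula.realize_bdEqual] using hi

/-- The coordinate germs of a Henkin family form a subfield of the ultrapower. -/
def IsHenkin.subfield (hU : IsHenkin A U) : Subfield (Germ (U : Filter (ℕ → K)) K) where
  carrier := Set.range (coordGerm U)
  mul_mem' := by
    rintro _ _ ⟨i, rfl⟩ ⟨j, rfl⟩
    obtain ⟨k, hk⟩ := hU.exists_eq (Term.var (Sum.inr 2))
      (mulTerm (Term.var (Sum.inr 0)) (Term.var (Sum.inr 1))) ![i, j]
    exact ⟨k, Germ.coe_eq.2 (hk.mono fun f hf => hf ⟨f i * f j, rfl⟩)⟩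
  one_mem' := by
    obtain ⟨k, hk⟩ := hU.exists_eq (Term.var (Sum.inr 0)) oneTerm ![]
    exact ⟨k, Germ.coe_eq.2 (hk.mono fun f hf => hf ⟨1, rfl⟩)⟩
  add_mem' := by
    rintro _ _ ⟨i, rfl⟩ ⟨j, rfl⟩
    obtain ⟨k, hk⟩ := hU.exists_eq (Term.var (Sum.inr 2))
      (addTerm (Term.var (Sum.inr 0)) (Term.var (Sum.inr 1))) ![i, j]
    exact ⟨k, Germ.coe_eq.2 (hk.mono fun f hf => hf ⟨f i + f j, rfl⟩)⟩
  zero_mem' := by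
    obtain ⟨k, hk⟩ := hU.exists_eq (Term.var (Sum.inr 0)) zeroTerm ![]
    exact ⟨k, Germ.coe_eq.2 (hk.mono fun f hf => hf ⟨0, rfl⟩)⟩
  neg_mem' := by
    rintro _ ⟨i, rfl⟩
    obtain ⟨k, hk⟩ := hU.exists_eq (Term.var (Sum.inr 1))
      (negTerm (Term.var (Sum.inr 0))) ![i]
    exact ⟨k, Germ.coe_eq.2 (hk.mono fun f hf => hf ⟨-f i, rfl⟩)⟩
  inv_mem' := by
    rintro _ ⟨i, rfl⟩
    -- The equation defining the inverse has no solution at `0`, so this case is separate.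
    by_cases h0 : coordGerm U i = 0
    · rw [h0, inv_zero, ← h0]
      exact ⟨i, rfl⟩
    obtain ⟨k, hk⟩ := hU.exists_eq
      (mulTerm (Term.var (Sum.inr 0)) (Term.var (Sum.inr 1))) oneTerm ![i]
    refine ⟨k, (eq_inv_of_mul_eq_one_right (Germ.coe_eq.2 ?_))⟩
    have h0' : ∀ᶠ f in (U : Filter (ℕ → K)), f i ≠ 0 :=
      Ultrafilter.eventually_not.2 fun h => h0 (Germ.coe_eq.2 h)
    filter_upwards [hk, h0'] with f hf hf0
    exact hf ⟨(f i)⁻¹, mul_inv_cancel₀ hf0⟩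

section Los

variable {L : Type*} [Field L] (ι : L →+* Germ (U : Filter (ℕ → K)) K) (a : ℕ → L)

theorem realize_term_generic (hι : ∀ i, ι (a i) = coordGerm U i)
    {n : ℕ} (t : macLang.Term (Empty ⊕ Fin n)) (xs : Fin n → ℕ) (B : ValuationSubring L) :
    ι (letI := macStructure B; t.realize (Sum.elim default (a ∘ xs))) =
      ((fun f => letI := macStructure A; t.realize (Sum.elim default (f ∘ xs)) : (ℕ → K) → K) :
        Germ (U : Filter (ℕ → K)) K) := by
  let _ := macStructure A
  let _ := macStructure B
  induction t with
  | var x =>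
    rcases x with x | x
    · exact x.elim
    · exact hι (xs x)
  | @func l F ts ih =>
    cases F with
    | add =>
      change ι ((ts 0).realize _ + (ts 1).realize _) = _
      rw [map_add, ih, ih]
      rfl
    | mul =>
      change ι ((ts 0).realize _ * (ts 1).realize _) = _
      rw [map_mul, ih, ih]
      rfl
    | neg =>
      change ι (- (ts 0).realize _) = _
      rw [map_neg, ih]
      rfl
    | zero => exact map_zero ι
    | one => exact map_one ι

/-- This is Łoś's theorem with the ultrapower replaced by the coordinate germs. Quantifiers, and the
roots hidden in the power predicates, range over fewer elements, and the Henkin property supplies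
the missing witnesses. -/
theorem realize_generic (hU : IsHenkin A U) (ha : Function.Surjective a)
    (hι : ∀ i, ι (a i) = coordGerm U i) {n : ℕ} (φ : macLang.BoundedFormula Empty n)
    (xs : Fin n → ℕ) :
    (letI := macStructure ((germValuationSubring A U).comap ι); φ.Realize default (a ∘ xs)) ↔
      ∀ᶠ f in (U : Filter (ℕ → K)), letI := macStructure A; φ.Realize default (f ∘ xs) := by
  set B := (germValuationSubring A U).comap ι with hB
  let _ := macStructure A
  let _ := macStructure B
  have hterm := fun {n : ℕ} (t : macLang.Term (Empty ⊕ Fin n)) (xs : Fin n → ℕ) =>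
    realize_term_generic (A := A) ι a hι t xs B
  induction φ with
  | falsum => exact Filter.eventually_false_iff_eq_bot.not.2 U.neBot.ne |> fun h =>
      ⟨False.elim, fun h' => h h'⟩
  | equal t₁ t₂ =>
    change t₁.realize _ = t₂.realize _ ↔ _
    rw [← ι.injective.eq_iff, hterm, hterm, Germ.coe_eq]
    rfl
  | rel R ts =>
    cases R with
    | valRing =>
      change (ts 0).realize _ ∈ B ↔ _
      rw [hB, ValuationSubring.mem_comap, hterm]
      rfl
    | pow m hm =>
      change ((ts 0).realize _ ≠ 0 ∧ ∃ y, (ts 0).realize _ = y ^ m) ↔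
        ∀ᶠ f in (U : Filter (ℕ → K)), ((ts 0).realize _ ≠ 0 ∧ ∃ y, (ts 0).realize _ = y ^ m)
      rw [eventually_and]
      refine and_congr ?_ ?_
      · rw [← ι.injective.ne_iff, hterm, map_zero, Ne, ← Germ.coe_zero, Germ.coe_eq]
        exact Ultrafilter.eventually_not.symm
      · constructor
        · rintro ⟨y, hy⟩
          obtain ⟨i, rfl⟩ := ha y
          have := congrArg ι hy
          rw [hterm, map_pow, hι] at this
          have h2 := Germ.coe_eq.1 this
          exact h2.mono fun f hf => ⟨_, hf⟩
        · intro h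
          obtain ⟨i, hi⟩ := hU.exists_eq
            ((ts 0).relabel (Sum.map id Fin.castSucc)) (powTerm (Term.var (Sum.inr (Fin.last _))) m)
            xs
          refine ⟨a i, ι.injective ?_⟩
          rw [hterm, map_pow, hι]
          refine Germ.coe_eq.2 ?_
          filter_upwards [h, hi] with f hf hfi
          have key : ∀ y : K, ((ts 0).relabel (Sum.map id Fin.castSucc)).realize
              (Sum.elim default (Fin.snoc (f ∘ xs) y)) =
              (ts 0).realize (Sum.elim default (f ∘ xs)) := by
            intro y
            rw [Term.realize_relabel]
            congr 1
            ext x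
            rcases x with x | x
            · exact x.elim
            · simp
          simp only [key, realize_powTerm, Term.realize_var, Sum.elim_inr, Fin.snoc_last] at hfi
          exact hfi hf
  | imp φ ψ ihφ ihψ =>
    simp only [BoundedFormula.realize_imp]
    exact (imp_congr (ihφ xs) (ihψ xs)).trans Ultrafilter.eventually_imp.symm
  | @all n φ ih =>
    have hsnoc : ∀ i, (Fin.snoc (a ∘ xs) (a i) : Fin (n + 1) → L) = a ∘ Fin.snoc xs i := by
      intro i
      rw [Fin.comp_snoc]
    rw [BoundedFormula.realize_all]
    simp only [BoundedFormula.realize_all]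
    constructor
    · intro h
      -- Coordinate `i` is a counterexample to `φ` whenever there is one, so testing `φ` at `a i`
      -- alone settles the universal quantifier.
      obtain ⟨i, hi⟩ := hU n φ.not xs
      have h1 := h (a i)
      rw [hsnoc] at h1
      replace h1 := (ih _).1 h1
      filter_upwards [h1, hi] with f hf hfi y
      by_contra hy
      refine hfi ⟨y, hy⟩ ?_
      rw [← Fin.comp_snoc]
      exact hf
    · intro h x
      obtain ⟨i, rfl⟩ := ha x
      rw [hsnoc]
      refine (ih _).2 ?_
      filter_upwards [h] with f hf
      rw [Fin.comp_snoc]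
      exact hf _

end Los

theorem realize_relabel_inr_pair {𝓛 : FirstOrder.Language} {M : Type*} [𝓛.Structure M]
    (φ : 𝓛.Formula (Fin 2)) (g : ℕ → M) (i j : ℕ) :
    (BoundedFormula.relabel (Sum.inr : Fin 2 → Empty ⊕ Fin 2) φ).Realize default (g ∘ ![i, j]) ↔
      φ.Realize ![g i, g j] := by
  rw [BoundedFormula.realize_relabel]
  refine iff_of_eq (congrArg₂ _ ?_ (Subsingleton.elim _ _))
  ext x
  fin_cases x <;> rfl

/-- Omitting types for valued fields in the Macintyre language. -/
theorem exists_macEquiv_omitting {κ : Type*} (σ : κ → macLang.Formula (Fin 2))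
    (hσ : letI := macStructure A
      ∀ (θ : macLang.Formula (Fin 2)) (v : Fin 2 → K), θ.Realize v →
        ∃ w : Fin 2 → K, θ.Realize w ∧ ∃ k, ¬ (σ k).Realize w) :
    ∃ (L : Type) (_ : Field L) (B : ValuationSubring L), MacEquiv B A ∧
      letI := macStructure B
      ∀ x y : L, ∃ k, ¬ (σ k).Realize ![x, y] := by
  let _ := macStructure A
  obtain ⟨U, hU, hom⟩ := exists_omitting_ultrafilter K σ hσ
  replace hU : IsHenkin A U := hU
  -- Countability makes the field small, so that it has a copy in `Type` whatever the universe of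
  -- `K`.
  have hc : Countable hU.subfield :=
    Set.countable_coe_iff.2 (Set.countable_range (coordGerm U))
  let e : Shrink.{0} hU.subfield ≃+* hU.subfield := (equivShrink.{0} hU.subfield).symm.ringEquiv
  let ι : Shrink.{0} hU.subfield →+* Germ (U : Filter (ℕ → K)) K :=
    hU.subfield.subtype.comp e.toRingHom
  let a : ℕ → Shrink.{0} hU.subfield := fun i => e.symm ⟨coordGerm U i, i, rfl⟩
  have hι : ∀ i, ι (a i) = coordGerm U i := fun i => by simp [ι, a]
  have ha : Function.Surjective a := by
    intro x
    obtain ⟨i, hi⟩ := (e x).2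
    refine ⟨i, ι.injective ?_⟩
    rw [hι, hi]
    rfl
  refine ⟨Shrink.{0} hU.subfield, inferInstance, (germValuationSubring A U).comap ι, ?_, ?_⟩
  · let _ := macStructure ((germValuationSubring A U).comap ι)
    refine (FirstOrder.Language.elementarilyEquivalent_iff).2 fun φ => ?_
    have := realize_generic ι a hU ha hι φ default
    have h1 : a ∘ (default : Fin 0 → ℕ) = default := Subsingleton.elim _ _
    have h2 : ∀ f : ℕ → K, f ∘ (default : Fin 0 → ℕ) = default := fun f => Subsingleton.elim _ _
    simp only [h1, h2, eventually_const] at this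
    exact this
  · let _ := macStructure ((germValuationSubring A U).comap ι)
    intro x y
    obtain ⟨i, rfl⟩ := ha x
    obtain ⟨j, rfl⟩ := ha y
    obtain ⟨k, hk⟩ := hom i j
    refine ⟨k, fun h => ?_⟩
    have hL : (BoundedFormula.relabel (Sum.inr : Fin 2 → Empty ⊕ Fin 2) (σ k)).Realize default
        (a ∘ ![i, j]) := (realize_relabel_inr_pair (σ k) a i j).2 h
    have hK := (realize_generic ι a hU ha hι _ _).1 hL
    obtain ⟨f, hf, hf'⟩ := (hK.and hk).exists
    exact hf' ((realize_relabel_inr_pair (σ k) f i j).1 hf)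

end MacintyreVal

/-! ### Roots of one-units from henselian coarsenings -/

namespace MacintyreVal

open Polynomial

/-- A nonzero polynomial is the product of a power of `X` and a polynomial with nonzero constant
coefficient. -/
theorem exists_eq_X_pow_mul {R : Type*} [CommRing R] {p : R[X]} (hp : p ≠ 0) :
    ∃ (j : ℕ) (a : R) (q : R[X]), a ≠ 0 ∧ p = X ^ j * (C a + X * q) := by
  obtain ⟨q, hq, hnd⟩ := exists_eq_pow_rootMultiplicity_mul_and_not_dvd p hp 0
  refine ⟨p.rootMultiplicity 0, q.coeff 0, q.divX, fun h => hnd ?_, ?_⟩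
  · rw [C_0, sub_zero]
    exact X_dvd_iff.2 h
  · conv_lhs => rw [hq, ← q.divX_mul_X_add]
    rw [C_0, sub_zero]
    ring

/-- Hensel's lemma for roots of one-units. -/
theorem exists_pow_eq_one_add {R : Type*} [CommRing R] [HenselianLocalRing R] {n : ℕ}
    (hn : 0 < n) (hu : IsUnit (n : R)) {e : R} (he : e ∈ IsLocalRing.maximalIdeal R) :
    ∃ y : R, y ^ n = 1 + e := by
  obtain ⟨y, hy, -⟩ := HenselianLocalRing.is_henselian (X ^ n - C (1 + e))
    (monic_X_pow_sub_C _ hn.ne') 1 (by simpa using he) (by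
      simpa [derivative_X_pow] using hu)
  exact ⟨y, by simpa [sub_eq_zero] using hy⟩

variable {K : Type*} [Field K] {A : ValuationSubring K}

theorem valuation_intCast [CharZero (IsLocalRing.ResidueField A)] {a : ℤ} (ha : a ≠ 0) :
    A.valuation (a : K) = 1 := by
  have : IsUnit (a : A) := by
    rw [← IsLocalRing.residue_ne_zero_iff_isUnit, map_intCast]
    exact_mod_cast ha
  simpa using (A.valuation_eq_one_iff (a : A)).1 this

theorem valuation_le_one_of_div {x y : K} (h : A.valuation x ≤ A.valuation y) :
    x / y ∈ A := by
  rw [← A.valuation_le_one_iff, map_div₀]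
  exact div_le_one_of_le₀ h zero_le

/-- The nonzero elements of a field generated by elements with values bounded by powers of `t`
have values bounded by powers of `t`. -/
theorem exists_pow_le_of_mem_subfield {S : Set K} {t : K}
    (hS : ∀ z ∈ Subring.closure S, z ≠ 0 →
      A.valuation z ≤ 1 ∧ ∃ k : ℕ, A.valuation (t ^ k) ≤ A.valuation z)
    {c : K} (hc : c ∈ Subfield.closure S) (hc0 : c ≠ 0) :
    ∃ k : ℕ, A.valuation (t ^ k) ≤ A.valuation c := by
  obtain ⟨y, hy, z, hz, rfl⟩ := Subfield.mem_closure_iff.1 hc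
  obtain ⟨hy0, hz0⟩ := div_ne_zero_iff.1 hc0
  obtain ⟨k, hk⟩ := (hS y hy hy0).2
  refine ⟨k, hk.trans ?_⟩
  rw [map_div₀]
  exact (le_div_iff₀ ((Valuation.pos_iff _).2 hz0)).2 (mul_le_of_le_one_right' (hS z hz hz0).1)

/-- As `z` is integral, it suffices to clear the denominators of the finitely many coefficients by
powers of `t`. -/
theorem exists_pow_mul_eval_le_one {E : Subfield K} {t : K} (ht1 : A.valuation t ≤ 1)
    (hE : ∀ c ∈ E, ∃ k : ℕ, A.valuation (t ^ k * c) ≤ 1) {z : K} (hz : A.valuation z ≤ 1)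
    (q : E[X]) : ∃ k : ℕ, A.valuation (t ^ k * aeval z q) ≤ 1 := by
  induction q using Polynomial.induction_on' with
  | add p q hp hq =>
    obtain ⟨k, hk⟩ := hp
    obtain ⟨l, hl⟩ := hq
    refine ⟨k + l, ?_⟩
    have : t ^ (k + l) * aeval z (p + q) =
        t ^ l * (t ^ k * aeval z p) + t ^ k * (t ^ l * aeval z q) := by
      rw [map_add]; ring
    rw [this]
    refine (A.valuation.map_add _ _).trans (max_le ?_ ?_)
    · rw [map_mul, map_pow]
      exact mul_le_one' (pow_le_one' ht1 _) hk
    · rw [map_mul, map_pow]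
      exact mul_le_one' (pow_le_one' ht1 _) hl
  | monomial n c =>
    obtain ⟨k, hk⟩ := hE c c.2
    refine ⟨k, ?_⟩
    rw [aeval_monomial, ← mul_assoc, map_mul, map_pow]
    exact mul_le_one' hk (pow_le_one' hz _)

/-- The constant coefficient of the minimal polynomial of `z` is `-(q(z) * z)`. Its value is bounded
by a power of `t`, and `q(z)` becomes integral after multiplication by a power of `t`; hence the
value of `z` is bounded too. Thus powers of `t` stay cofinal under algebraic extension. -/
theorem exists_pow_le_of_isAlgebraic {S : Set K} {t : K}
    (ht1 : A.valuation t < 1)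
    (hS : ∀ z ∈ Subring.closure S, z ≠ 0 →
      A.valuation z ≤ 1 ∧ ∃ k : ℕ, A.valuation (t ^ k) ≤ A.valuation z)
    {z : K} (hz : IsAlgebraic (Subfield.closure S) z) (hz0 : z ≠ 0) :
    ∃ k : ℕ, A.valuation (t ^ k) ≤ A.valuation z := by
  rcases le_total 1 (A.valuation z) with h1 | h1
  · exact ⟨0, by simpa using h1⟩
  have hE : ∀ c ∈ Subfield.closure S, ∃ k : ℕ, A.valuation (t ^ k * c) ≤ 1 := by
    intro c hc
    rcases eq_or_ne c 0 with rfl | hc0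
    · exact ⟨0, by simp⟩
    obtain ⟨k, hk⟩ := exists_pow_le_of_mem_subfield hS (inv_mem hc) (inv_ne_zero hc0)
    refine ⟨k, ?_⟩
    rw [map_inv₀] at hk
    rw [map_mul]
    calc _ ≤ (A.valuation c)⁻¹ * A.valuation c := mul_le_mul_left hk _
      _ = 1 := inv_mul_cancel₀ ((Valuation.ne_zero_iff _).2 hc0)
  set p := minpoly (Subfield.closure S) z with hp
  have hp0 : p.coeff 0 ≠ 0 := minpoly.coeff_zero_ne_zero hz.isIntegral hz0
  have hc : ((p.coeff 0 : Subfield.closure S) : K) = -(aeval z p.divX * z) := by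
    have h0 : aeval z p = 0 := minpoly.aeval _ _
    rw [← p.divX_mul_X_add, map_add, map_mul, aeval_X, aeval_C] at h0
    exact eq_neg_of_add_eq_zero_right h0
  obtain ⟨k, hk⟩ := exists_pow_mul_eval_le_one ht1.le hE h1 p.divX
  obtain ⟨l, hl⟩ := exists_pow_le_of_mem_subfield hS (p.coeff 0).2 (by simpa using hp0)
  refine ⟨k + l, ?_⟩
  rw [pow_add, map_mul]
  refine (mul_le_mul_right hl _).trans ?_
  rw [hc, Valuation.map_neg, ← map_mul, ← mul_assoc, map_mul]
  exact mul_le_of_le_one_left' hk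

/-- If the restriction of `A` to the relative algebraic closure of the field generated by `S` has a
henselian coarsening, then that field contains roots of its elements that are sufficiently close
to one. -/
theorem HasHenselianCoarsening.exists_pow_eq [CharZero (IsLocalRing.ResidueField A)] {S : Set K}
    (h : HasHenselianCoarsening (A.comap (algebraMap (relAlgClosure S) K))) {t : K} (htS : t ∈ S)
    (ht0 : t ≠ 0) (ht1 : A.valuation t < 1)
    (hS : ∀ z ∈ Subring.closure S, z ≠ 0 →
      A.valuation z ≤ 1 ∧ ∃ k : ℕ, A.valuation (t ^ k) ≤ A.valuation z)
    {e : K} (heS : e ∈ Subfield.closure S) (het : A.valuation (e ^ 2) ≤ A.valuation t) {n : ℕ}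
    (hn : 0 < n) : ∃ y : K, y ≠ 0 ∧ y ^ n = 1 + e := by
  obtain ⟨D, hAD, hD, hens⟩ := h
  have hmem : ∀ {c}, c ∈ Subfield.closure S → c ∈ relAlgClosure S := fun {c} hc =>
    (relAlgClosure S).algebraMap_mem ⟨c, hc⟩
  let t' : relAlgClosure S := ⟨t, hmem (Subfield.subset_closure htS)⟩
  let e' : relAlgClosure S := ⟨e, hmem heS⟩
  have hle : ∀ x y : relAlgClosure S, y ≠ 0 → A.valuation (x : K) ≤ A.valuation (y : K) →
      D.valuation x ≤ D.valuation y := by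
    intro x y hy hxy
    have h1 : x / y ∈ D := hAD (by
      rw [ValuationSubring.mem_comap, map_div₀]
      exact valuation_le_one_of_div hxy)
    rw [← D.valuation_le_one_iff, map_div₀] at h1
    exact (div_le_one₀ ((Valuation.pos_iff _).2 hy)).1 h1
  have ht'0 : t' ≠ 0 := fun h => ht0 (congrArg Subtype.val h)
  -- For `z` outside `D`, some power of `t` is at least as small as `z⁻¹` for `A`, hence for `D`,
  -- and `z⁻¹` is a non-unit of `D`.
  have ht' : D.valuation t' < 1 := by
    obtain ⟨z, hz⟩ : ∃ z, z ∉ D := by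
      by_contra! h
      exact hD (eq_top_iff.2 fun x _ => h x)
    have hz0 : z ≠ 0 := fun h => hz (h ▸ D.zero_mem)
    rw [← D.valuation_le_one_iff, not_le] at hz
    obtain ⟨k, hk⟩ := exists_pow_le_of_isAlgebraic ht1 hS
      (mem_algebraicClosure_iff.1 (z⁻¹).2) (by simpa using hz0)
    have h1 := hle (t' ^ k) z⁻¹ (inv_ne_zero hz0) hk
    rw [map_pow, map_inv₀] at h1
    by_contra! h2
    exact absurd ((one_le_pow₀ h2).trans h1) (not_le.2 (inv_lt_one_of_one_lt₀ hz))
  have he' : D.valuation e' < 1 := by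
    have h1 := hle (e' ^ 2) t' ht'0 het
    rw [map_pow] at h1
    by_contra! h2
    exact absurd ((one_le_pow₀ h2).trans h1) (not_le.2 ht')
  let e'' : D := ⟨e', (D.valuation_le_one_iff _).1 he'.le⟩
  have hnu : IsUnit (n : D) := by
    rw [D.valuation_eq_one_iff]
    have h1 : A.valuation ((n : ℤ) : K) = 1 := valuation_intCast (by exact_mod_cast hn.ne')
    rw [Int.cast_natCast] at h1
    have hn0 : (n : K) ≠ 0 := by
      intro h0
      rw [h0, map_zero] at h1
      exact zero_ne_one h1
    have hn0' : (n : relAlgClosure S) ≠ 0 := fun h => hn0 (by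
      simpa using congrArg (algebraMap (relAlgClosure S) K) h)
    have h2 := hle n 1 one_ne_zero (by simp [h1])
    have h3 := hle 1 n hn0' (by simp [h1])
    rw [map_one] at h2 h3
    simpa using le_antisymm h2 h3
  obtain ⟨y, hy⟩ := exists_pow_eq_one_add hn hnu (e := e'') ((D.valuation_lt_one_iff _).2 he')
  have hy' : ((y : relAlgClosure S) : K) ^ n = 1 + e := by
    simpa using congrArg (fun x : D => ((x : relAlgClosure S) : K)) hy
  -- If `y = 0` then `e = -1`, which is not small.
  refine ⟨(y : relAlgClosure S), fun h0 => ?_, hy'⟩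
  rw [h0, zero_pow hn.ne'] at hy'
  rw [eq_neg_of_add_eq_zero_right hy'.symm] at het
  simp only [neg_one_sq, map_one] at het
  exact absurd het (not_le.2 ht1)

end MacintyreVal

/-! ### Dominant monomials and perturbation of a pair -/

namespace MacintyreVal

open Polynomial

variable {K : Type*} [Field K]

/-- The evaluation of a polynomial in two variables. -/
noncomputable def evalPair (x y : K) : ℤ[X][X] →+* K :=
  eval₂RingHom (aeval x : ℤ[X] →ₐ[ℤ] K).toRingHom y

@[simp]
theorem evalPair_X (x y : K) : evalPair x y X = y := by simp [evalPair]

@[simp]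
theorem evalPair_C (x y : K) (q : ℤ[X]) : evalPair x y (C q) = aeval x q := by simp [evalPair]

theorem aeval_mem_subring {R : Subring K} {x : K} (hx : x ∈ R) (q : ℤ[X]) : aeval x q ∈ R := by
  rw [aeval_eq_sum_range]
  exact sum_mem fun i _ => zsmul_mem (pow_mem hx i) _

theorem evalPair_mem_subring {R : Subring K} {x y : K} (hx : x ∈ R) (hy : y ∈ R) (p : ℤ[X][X]) :
    evalPair x y p ∈ R := by
  rw [evalPair, coe_eval₂RingHom, eval₂_eq_sum]
  exact sum_mem fun i _ => mul_mem (aeval_mem_subring hx _) (pow_mem hy i)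

theorem exists_aeval_eq {q : ℤ[X]} (hq : q ≠ 0) : ∃ (i : ℕ) (a : ℤ) (s : ℤ[X]), a ≠ 0 ∧
    ∀ x : K, aeval x q = x ^ i * (a + x * aeval x s) := by
  obtain ⟨i, a, s, ha, rfl⟩ := exists_eq_X_pow_mul hq
  exact ⟨i, a, s, ha, fun x => by simp⟩

/-- This isolates the monomial `a * x ^ i * y ^ j` that dominates when `x ≪ y`: the least power of
`y` is split off first, then the least power of `x` in its coefficient. The decomposition does not
depend on the point, so it serves both pairs. -/
theorem exists_evalPair_eq {p : ℤ[X][X]} (hp : p ≠ 0) :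
    ∃ (j i : ℕ) (a : ℤ) (s : ℤ[X]) (r : ℤ[X][X]), a ≠ 0 ∧ ∀ x y : K,
      evalPair x y p = y ^ j * (x ^ i * (a + x * aeval x s) + y * evalPair x y r) := by
  obtain ⟨j, q, r, hq, rfl⟩ := exists_eq_X_pow_mul hp
  obtain ⟨i, a, s, ha, h⟩ := exists_aeval_eq (K := K) hq
  exact ⟨j, i, a, s, r, ha, fun x y => by simp [h]⟩

variable {A : ValuationSubring K} {x y : K}

theorem aeval_mem (hx : A.valuation x < 1) (q : ℤ[X]) : A.valuation (aeval x q) ≤ 1 :=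
  (A.valuation_le_one_iff _).2
    (aeval_mem_subring (R := A.toSubring) ((A.valuation_le_one_iff x).1 hx.le) q)

theorem evalPair_mem (hx : A.valuation x < 1) (hy : A.valuation y < 1) (p : ℤ[X][X]) :
    A.valuation (evalPair x y p) ≤ 1 :=
  (A.valuation_le_one_iff _).2
    (evalPair_mem_subring (R := A.toSubring) ((A.valuation_le_one_iff x).1 hx.le)
      ((A.valuation_le_one_iff y).1 hy.le) p)

section ResidueCharZero

variable [CharZero (IsLocalRing.ResidueField A)]

theorem valuation_int_add (hx : A.valuation x < 1) {a : ℤ} (ha : a ≠ 0) (s : ℤ[X]) :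
    A.valuation (a + x * aeval x s) = 1 := by
  rw [A.valuation.map_add_eq_of_lt_left, valuation_intCast ha]
  rw [valuation_intCast ha, map_mul]
  exact mul_lt_one_of_lt_of_le hx (aeval_mem hx s)

theorem valuation_evalPair_inner (hx : A.valuation x < 1) (hxy : ∀ n : ℕ,
    A.valuation y < A.valuation (x ^ n)) {a : ℤ} (ha : a ≠ 0) (i : ℕ) (s : ℤ[X]) (r : ℤ[X][X]) :
    A.valuation (x ^ i * (a + x * aeval x s) + y * evalPair x y r) = A.valuation (x ^ i) := by
  have hy : A.valuation y < 1 := by simpa using hxy 0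
  have h : A.valuation (x ^ i * (a + x * aeval x s)) = A.valuation (x ^ i) := by
    rw [map_mul, valuation_int_add hx ha, mul_one]
  rw [A.valuation.map_add_eq_of_lt_left, h]
  rw [h, map_mul]
  exact (mul_le_of_le_one_right' (evalPair_mem hx hy r)).trans_lt (hxy i)

theorem bounded_closure_singleton (hx : A.valuation x < 1) :
    ∀ z ∈ Subring.closure {x}, z ≠ 0 →
      A.valuation z ≤ 1 ∧ ∃ k : ℕ, A.valuation (x ^ k) ≤ A.valuation z := by
  intro z hz hz0
  have hle : Subring.closure {x} ≤ (aeval x : ℤ[X] →ₐ[ℤ] K).toRingHom.range :=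
    Subring.closure_le.2 (Set.singleton_subset_iff.2 ⟨X, aeval_X x⟩)
  obtain ⟨q, rfl⟩ := hle hz
  refine ⟨aeval_mem hx q, ?_⟩
  have hq : q ≠ 0 := by
    rintro rfl
    exact hz0 (map_zero _)
  obtain ⟨i, a, s, ha, h⟩ := exists_aeval_eq (K := K) hq
  refine ⟨i, ?_⟩
  change _ ≤ A.valuation (aeval x q)
  rw [h, map_mul _ (x ^ i), valuation_int_add hx ha, mul_one]

theorem bounded_closure_pair (hx : A.valuation x < 1) (hxy : ∀ n : ℕ,
    A.valuation y < A.valuation (x ^ n)) :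
    ∀ z ∈ Subring.closure {x, y}, z ≠ 0 →
      A.valuation z ≤ 1 ∧ ∃ k : ℕ, A.valuation (y ^ k) ≤ A.valuation z := by
  intro z hz hz0
  have hy : A.valuation y < 1 := by simpa using hxy 0
  have hle : Subring.closure {x, y} ≤ (evalPair x y).range :=
    Subring.closure_le.2 (Set.insert_subset ⟨C X, by simp⟩
      (Set.singleton_subset_iff.2 ⟨X, evalPair_X x y⟩))
  obtain ⟨p, rfl⟩ := hle hz
  refine ⟨evalPair_mem hx hy p, ?_⟩
  have hp : p ≠ 0 := by
    rintro rfl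
    exact hz0 (map_zero _)
  obtain ⟨j, i, a, s, r, ha, h⟩ := exists_evalPair_eq (K := K) hp
  -- The extra factor `y` absorbs `x ^ i`.
  refine ⟨j + 1, ?_⟩
  rw [h, map_mul _ (y ^ j), valuation_evalPair_inner hx hxy ha, pow_succ, map_mul]
  exact mul_le_mul_right (hxy i).le _

/-- Perturbing a pair `x ≪ y` to a pair of comparable elements changes the value of a polynomial
only by an `m`-th power. -/
theorem exists_evalPair_perturb (hx : A.valuation x < 1) (hxy : ∀ n : ℕ,
    A.valuation y < A.valuation (x ^ n)) (hy0 : y ≠ 0)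
    (h₁ : HasHenselianCoarsening (A.comap (algebraMap (relAlgClosure {x}) K)))
    (h₂ : HasHenselianCoarsening (A.comap (algebraMap (relAlgClosure {x, y}) K)))
    {p : ℤ[X][X]} (hp : p ≠ 0) {m : ℕ} (hm : 0 < m) :
    evalPair x y p ≠ 0 ∧ ∃ N₀ : ℕ, ∀ N ≥ N₀, ∃ u : K, u ≠ 0 ∧
      evalPair (x * y ^ m) (y ^ (1 + m * N)) p = evalPair x y p * u ^ m := by
  have hx0 : x ≠ 0 := by
    rintro rfl
    simpa using hxy 1
  have hy : A.valuation y < 1 := by simpa using hxy 0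
  obtain ⟨j, i, a, s, r, ha, h⟩ := exists_evalPair_eq (K := K) hp
  have ha1 : A.valuation (a : K) = 1 := valuation_intCast ha
  have ha0 : (a : K) ≠ 0 := (Valuation.ne_zero_iff A.valuation).1 (by simp [ha1])
  have hxi : x ^ i ≠ 0 := pow_ne_zero i hx0
  have hb1 := valuation_int_add hx ha s
  have hb0 : a + x * aeval x s ≠ 0 := (Valuation.ne_zero_iff A.valuation).1 (by simp [hb1])
  have hxS : x ∈ Subfield.closure {x, y} := Subfield.subset_closure (by simp)
  have hyS : y ∈ Subfield.closure {x, y} := Subfield.subset_closure (by simp)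
  have haS : ∀ S : Set K, (a : K) ∈ Subfield.closure S := fun S => intCast_mem _ a
  have hsq : ∀ {e t : K}, A.valuation t < 1 → A.valuation e ≤ A.valuation t →
      A.valuation (e ^ 2) ≤ A.valuation t := fun {e t} ht he => by
    rw [map_pow, sq]
    exact (mul_le_of_le_one_right' (he.trans ht.le)).trans he
  -- This correction is only known to be small on the scale of `x`. A proper coarsening on the
  -- closure generated by `x` and `y` may make `x` a unit, so `h₁` is needed.
  obtain ⟨u₁, hu₁, hu₁'⟩ := h₁.exists_pow_eq (Set.mem_singleton x) hx0 hx
    (bounded_closure_singleton hx) (e := x * aeval x s / a)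
    (div_mem (mul_mem (Subfield.subset_closure rfl)
      (aeval_mem_subring (R := (Subfield.closure {x}).toSubring)
        (Subfield.subset_closure rfl) s)) (haS _))
    (hsq hx (by
      rw [map_div₀, ha1, div_one, map_mul]
      exact mul_le_of_le_one_right' (aeval_mem hx s))) hm
  -- Dividing by `x ^ i` makes the value of `e` possibly smaller than `v y`, but twice that value
  -- still reaches `v y` because `2 * i * v x < v y`. Hence the bound on `e ^ 2` in the root lemma.
  obtain ⟨u₂, hu₂, hu₂'⟩ := h₂.exists_pow_eq (t := y) (by simp) hy0 hy
    (bounded_closure_pair hx hxy)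
    (e := y * evalPair x y r / (x ^ i * (a + x * aeval x s)))
    (div_mem (mul_mem hyS (evalPair_mem_subring (R := (Subfield.closure {x, y}).toSubring)
      hxS hyS r)) (mul_mem (pow_mem hxS i) (add_mem (haS _) (mul_mem hxS
        (aeval_mem_subring (R := (Subfield.closure {x, y}).toSubring) hxS s)))))
    (by
      rw [div_pow, map_div₀, mul_pow _ _ 2, mul_pow _ _ 2, map_mul, map_mul, map_pow _ (_ + _), hb1,
        one_pow, mul_one, ← pow_mul]
      refine (div_le_iff₀ ((Valuation.pos_iff _).2 (pow_ne_zero _ hx0))).2 ?_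
      rw [map_pow _ (evalPair x y r), sq y, map_mul, mul_assoc]
      refine mul_le_mul_right ((mul_le_of_le_one_right' (pow_le_one' (evalPair_mem hx hy r) _)).trans
        (hxy _).le) _) hm
  have hval : evalPair x y p = y ^ j * x ^ i * a * u₁ ^ m * u₂ ^ m := by
    rw [h, hu₁', hu₂']
    field_simp
  -- With `N ≥ i + 1`, the power `y'` contains `y * (y ^ m) ^ i` and at least one more factor `y ^
  -- m`, which outweighs `x ^ i`; so `y'` is divisible by `y * x' ^ i`.
  refine ⟨?_, i + 1, fun N hN => ?_⟩
  · rw [hval]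
    positivity
  obtain ⟨N, rfl⟩ := Nat.exists_eq_add_of_le hN
  set x' := x * y ^ m with hx'
  set y' := y ^ (1 + m * (i + 1 + N)) with hy'
  have hym : A.valuation (y ^ m) ≤ A.valuation y := by
    rw [map_pow]
    exact pow_le_of_le_one zero_le hy.le hm.ne'
  have hx'y : A.valuation x' ≤ A.valuation y := by
    rw [hx', map_mul]
    exact (mul_le_of_le_one_left' hx.le).trans hym
  have hx'1 : A.valuation x' < 1 := hx'y.trans_lt hy
  have hy'1 : A.valuation y' < 1 := by
    rw [hy', map_pow]
    exact pow_lt_one₀ zero_le hy (by omega)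
  have hx'0 : x' ≠ 0 := mul_ne_zero hx0 (pow_ne_zero m hy0)
  have hx'S : x' ∈ Subfield.closure {x, y} := mul_mem hxS (pow_mem hyS m)
  have hy'S : y' ∈ Subfield.closure {x, y} := pow_mem hyS _
  have hyx' : A.valuation y' ≤ A.valuation y * A.valuation (x' ^ i) := by
    have : y' = y * (y ^ (m * (1 + N)) * (y ^ m) ^ i) := by
      rw [hy']; ring
    rw [this, map_mul, hx', mul_pow, map_mul, map_mul]
    refine mul_le_mul_right (mul_le_mul_left (le_trans ?_ (hxy i).le) _) _
    rw [map_pow]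
    exact pow_le_of_le_one zero_le hy.le (by positivity)
  -- Now `v x' ≥ v y`, so both corrections are small on the scale of `y` and are treated together by
  -- `h₂`.
  obtain ⟨u₃, hu₃, hu₃'⟩ := h₂.exists_pow_eq (t := y) (by simp) hy0 hy
    (bounded_closure_pair hx hxy)
    (e := x' * aeval x' s / a + y' * evalPair x' y' r / (a * x' ^ i))
    (add_mem (div_mem (mul_mem hx'S
      (aeval_mem_subring (R := (Subfield.closure {x, y}).toSubring) hx'S s)) (haS _))
      (div_mem (mul_mem hy'S (evalPair_mem_subring (R := (Subfield.closure {x, y}).toSubring)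
        hx'S hy'S r)) (mul_mem (haS _) (pow_mem hx'S i))))
    (hsq hy ((A.valuation.map_add _ _).trans (max_le
      (by
        rw [map_div₀, ha1, div_one, map_mul]
        exact (mul_le_of_le_one_right' (aeval_mem hx'1 s)).trans hx'y)
      (by
        rw [map_div₀, map_mul, map_mul, ha1, one_mul]
        refine (div_le_iff₀ ((Valuation.pos_iff _).2 (pow_ne_zero _ hx'0))).2 ?_
        exact (mul_le_of_le_one_right' (evalPair_mem hx'1 hy'1 r)).trans hyx')))) hm
  -- The power of `y` is the `m`-th root of the quotient of `y' ^ j * x' ^ i` by `y ^ j * x ^ i`.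
  refine ⟨y ^ ((i + 1 + N) * j + i) * u₃ / (u₁ * u₂), by positivity, ?_⟩
  have hval' : evalPair x' y' p = y' ^ j * x' ^ i * a * u₃ ^ m := by
    rw [h, hu₃']
    field_simp
    ring
  rw [hval, hval', hx', hy', div_pow, mul_pow, mul_pow, mul_pow]
  field_simp
  ring

end ResidueCharZero

end MacintyreVal

/-! ### The gap type is not isolated -/

namespace MacintyreVal

open FirstOrder.Language

variable {K : Type*} [Field K] {A : ValuationSubring K}

theorem exists_evalPair_eq_realize (t : macLang.Term (Fin 2 ⊕ Fin 0)) :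
    ∃ p, ∀ (x y : K) (xs : Fin 0 → K),
      (letI := macStructure A; t.realize (Sum.elim ![x, y] xs)) = evalPair x y p := by
  let _ := macStructure A
  induction t with
  | var i =>
    rcases i with i | i
    · fin_cases i
      · exact ⟨Polynomial.C Polynomial.X, fun x y xs => by simp⟩
      · exact ⟨Polynomial.X, fun x y xs => by simp⟩
    · exact i.elim0
  | @func l F ts ih =>
    choose p hp using ih
    cases F with
    | add =>
      refine ⟨p 0 + p 1, fun x y xs => ?_⟩
      rw [map_add, ← hp 0 x y xs, ← hp 1 x y xs]
      rfl
    | mul =>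
      refine ⟨p 0 * p 1, fun x y xs => ?_⟩
      rw [map_mul, ← hp 0 x y xs, ← hp 1 x y xs]
      rfl
    | neg =>
      refine ⟨-p 0, fun x y xs => ?_⟩
      rw [map_neg, ← hp 0 x y xs]
      rfl
    | zero => exact ⟨0, fun x y xs => (map_zero _).symm⟩
    | one => exact ⟨1, fun x y xs => (map_one _).symm⟩

/-- A quantifier-free formula that holds for a pair `x ≪ y` holds for some pairs of comparable
elements. -/
theorem exists_realize_perturb [CharZero (IsLocalRing.ResidueField A)] {x y : K}
    (hx : A.valuation x < 1) (hxy : ∀ n : ℕ, A.valuation y < A.valuation (x ^ n)) (hy0 : y ≠ 0)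
    (h₁ : HasHenselianCoarsening (A.comap (algebraMap (relAlgClosure {x}) K)))
    (h₂ : HasHenselianCoarsening (A.comap (algebraMap (relAlgClosure {x, y}) K)))
    {n : ℕ} {φ : macLang.BoundedFormula (Fin 2) n} (hφ : φ.IsQF) (hn : n = 0) :
    ∃ M : ℕ, 0 < M ∧ ∀ m : ℕ, 0 < m → M ∣ m → ∃ N₀ : ℕ, ∀ N ≥ N₀, ∀ xs : Fin n → K,
      letI := macStructure A
      (φ.Realize ![x, y] xs ↔ φ.Realize ![x * y ^ m, y ^ (1 + m * N)] xs) := by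
  let _ := macStructure A
  subst hn
  have hy : A.valuation y < 1 := by simpa using hxy 0
  induction hφ with
  | falsum => exact ⟨1, one_pos, fun m _ _ => ⟨0, fun _ _ _ => Iff.rfl⟩⟩
  | of_isAtomic h =>
    cases h with
    | equal t₁ t₂ =>
      obtain ⟨p, hp⟩ := exists_evalPair_eq_realize (A := A) t₁
      obtain ⟨q, hq⟩ := exists_evalPair_eq_realize (A := A) t₂
      refine ⟨1, one_pos, fun m hm _ => ?_⟩
      simp only [BoundedFormula.realize_bdEqual, hp, hq]
      by_cases hpq : p = q
      · subst hpq
        exact ⟨0, fun _ _ _ => by simp⟩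
      · obtain ⟨h0, N₀, hN⟩ := exists_evalPair_perturb hx hxy hy0 h₁ h₂ (sub_ne_zero.2 hpq) hm
        refine ⟨N₀, fun N hN' _ => ?_⟩
        obtain ⟨u, hu, hu'⟩ := hN N hN'
        rw [← sub_eq_zero, ← map_sub, ← sub_eq_zero (a := evalPair (x * y ^ m) _ p), ← map_sub, hu']
        simp [hu, hm.ne']
    | rel R ts =>
      cases R with
      | valRing =>
        obtain ⟨p, hp⟩ := exists_evalPair_eq_realize (A := A) (ts 0)
        -- Integer polynomials in elements of the maximal ideal are integral, so both sides are
        -- true.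
        refine ⟨1, one_pos, fun m hm _ => ⟨0, fun N _ xs => ?_⟩⟩
        change (ts 0).realize _ ∈ A ↔ (ts 0).realize _ ∈ A
        rw [hp, hp, ← A.valuation_le_one_iff, ← A.valuation_le_one_iff]
        refine iff_of_true (evalPair_mem hx hy p) (evalPair_mem ?_ ?_ p)
        · rw [map_mul, map_pow]
          exact mul_lt_one_of_lt_of_le hx (pow_le_one' hy.le m)
        · rw [map_pow]
          exact pow_lt_one₀ zero_le hy (by omega)
      | pow l hl =>
        obtain ⟨p, hp⟩ := exists_evalPair_eq_realize (A := A) (ts 0)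
        -- For `m` divisible by `l`, a factor `u ^ m` is an `l`-th power and does not affect the
        -- predicate.
        refine ⟨l, by omega, fun m hm ⟨d, hd⟩ => ?_⟩
        change ∃ N₀ : ℕ, ∀ N ≥ N₀, ∀ xs : Fin 0 → K,
          ((ts 0).realize _ ≠ 0 ∧ ∃ z, (ts 0).realize _ = z ^ l) ↔
          ((ts 0).realize _ ≠ 0 ∧ ∃ z, (ts 0).realize _ = z ^ l)
        simp only [hp]
        by_cases hp0 : p = 0
        · exact ⟨0, fun N _ _ => by simp [hp0]⟩
        · obtain ⟨h0, N₀, hN⟩ := exists_evalPair_perturb hx hxy hy0 h₁ h₂ hp0 hm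
          refine ⟨N₀, fun N hN' _ => ?_⟩
          obtain ⟨u, hu, hu'⟩ := hN N hN'
          have hum : u ^ m = (u ^ d) ^ l := by rw [hd, ← pow_mul, mul_comm]
          rw [hu', hum]
          have hud : u ^ d ≠ 0 := pow_ne_zero _ hu
          refine and_congr (by simp [hu]) ⟨?_, ?_⟩
          · rintro ⟨z, hz⟩
            exact ⟨z * u ^ d, by rw [hz, mul_pow]⟩
          · rintro ⟨z, hz⟩
            refine ⟨z / u ^ d, ?_⟩
            rw [div_pow, ← hz, mul_div_cancel_right₀ _ (pow_ne_zero _ hud)]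
  | imp _ _ ih₁ ih₂ =>
    obtain ⟨M₁, hM₁, h₁'⟩ := ih₁
    obtain ⟨M₂, hM₂, h₂'⟩ := ih₂
    -- Allowing all multiples `m` of `M` and all large `N` is what lets the two subformulas share
    -- one perturbation.
    refine ⟨M₁ * M₂, by positivity, fun m hm hdvd => ?_⟩
    obtain ⟨N₁, hN₁⟩ := h₁' m hm (dvd_of_mul_right_dvd hdvd)
    obtain ⟨N₂, hN₂⟩ := h₂' m hm (dvd_of_mul_left_dvd hdvd)
    refine ⟨max N₁ N₂, fun N hN xs => ?_⟩
    simp only [BoundedFormula.realize_imp]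
    exact imp_congr (hN₁ N (le_of_max_le_left hN) xs) (hN₂ N (le_of_max_le_right hN) xs)

/-- The formula expressing that the value of `s` is larger than the value of `t`. -/
def ltFormula (s t : macLang.Term (Fin 2)) : macLang.Formula (Fin 2) :=
  (((Relations.boundedFormula₁ (L := macLang) (MacRel.valRing : macLang.Relations 1)
    (Term.var (Sum.inr 0)) ⊓ (t.relabel Sum.inl).bdEqual
      (mulTerm (Term.var (Sum.inr 0)) (s.relabel Sum.inl)) :
        macLang.BoundedFormula (Fin 2) 1)).ex).not

theorem realize_ltFormula (s t : macLang.Term (Fin 2)) (v : Fin 2 → K) :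
    letI := macStructure A
    (ltFormula s t).Realize v ↔ A.valuation (s.realize v) < A.valuation (t.realize v) := by
  let _ := macStructure A
  have h : (ltFormula s t).Realize v ↔ ¬ ∃ w, w ∈ A ∧ t.realize v = w * s.realize v := by
    rw [ltFormula, Formula.Realize, BoundedFormula.realize_not, BoundedFormula.realize_ex]
    simp only [BoundedFormula.realize_inf, BoundedFormula.realize_bdEqual, realize_mulTerm,
      Term.realize_relabel, Sum.elim_comp_inl]
    rfl
  rw [h, not_iff_comm, not_lt]
  constructor
  · intro hle
    rcases eq_or_ne (s.realize v) 0 with h0 | h0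
    · rw [h0, map_zero, le_zero_iff, Valuation.zero_iff] at hle
      exact ⟨0, A.zero_mem, by rw [hle, zero_mul]⟩
    · exact ⟨_, valuation_le_one_of_div hle, (div_mul_cancel₀ _ h0).symm⟩
  · rintro ⟨w, hw, h⟩
    rw [h, map_mul]
    exact mul_le_of_le_one_left' ((A.valuation_le_one_iff w).2 hw)

/-- The formulas of the type `{0 < v (X ^ n) < v Y ∧ Y ≠ 0 : n ≥ 1}`. -/
def gapFormula (k : ℕ) : macLang.Formula (Fin 2) :=
  ltFormula (powTerm (Term.var 0) (k + 1)) oneTerm ⊓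
    (ltFormula (Term.var 1) (powTerm (Term.var 0) (k + 1)) ⊓
      ((Term.var 1).equal zeroTerm).not)

theorem realize_gapFormula (k : ℕ) (v : Fin 2 → K) :
    letI := macStructure A
    (gapFormula k).Realize v ↔ A.valuation (v 0 ^ (k + 1)) < 1 ∧
      A.valuation (v 1) < A.valuation (v 0 ^ (k + 1)) ∧ v 1 ≠ 0 := by
  let _ := macStructure A
  rw [gapFormula, Formula.realize_inf, Formula.realize_inf, realize_ltFormula, realize_ltFormula,
    Formula.realize_not, Formula.realize_equal, realize_powTerm, realize_oneTerm, map_one]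
  rfl

theorem realizesGapType_iff (x y : K) : letI := macStructure A
    RealizesGapType A x y ↔ ∀ k, (gapFormula k).Realize ![x, y] := by
  let _ := macStructure A
  simp only [realize_gapFormula]
  constructor
  · intro h k
    exact h (k + 1) (by omega)
  · intro h n hn
    obtain ⟨k, rfl⟩ := Nat.exists_eq_add_of_le' hn
    exact h k

theorem muchSmaller_of_gap {x y : K}
    (hxy : ∀ n : ℕ, A.valuation y < A.valuation (x ^ n)) : MuchSmaller A x y := by
  have hy : A.valuation y < 1 := by simpa using hxy 0
  have h1 : A.valuation y < A.valuation x := by simpa using hxy 1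
  refine ⟨?_, h1⟩
  rintro ⟨n, hn, ⟨h, -⟩ | ⟨-, h⟩⟩
  · exact absurd h (not_le.2 (hxy _))
  · refine absurd (h.trans ?_) (not_le.2 h1)
    rw [map_pow]
    exact pow_le_of_le_one zero_le hy.le (by omega)

/-- No formula isolates the gap type. -/
theorem exists_realize_not_gapFormula [CharZero (IsLocalRing.ResidueField A)]
    (hQE : AdmitsQE (macTheory A)) (hpro : ProhenselianOfDegree A 2) :
    letI := macStructure A
    ∀ (θ : macLang.Formula (Fin 2)) (v : Fin 2 → K), θ.Realize v →
      ∃ w : Fin 2 → K, θ.Realize w ∧ ∃ k, ¬ (gapFormula k).Realize w := by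
  let _ := macStructure A
  intro θ v hv
  by_contra! hcon
  have hgap : ∀ k, _ := fun k => (realize_gapFormula (A := A) k v).1 (hcon v hv k)
  set x := v 0
  set y := v 1
  have hvxy : v = ![x, y] := by
    ext i
    fin_cases i <;> rfl
  have hx : A.valuation x < 1 := by simpa using (hgap 0).1
  have hy0 : y ≠ 0 := (hgap 0).2.2
  have hxy : ∀ n : ℕ, A.valuation y < A.valuation (x ^ n) := by
    intro n
    cases n with
    | zero => rw [pow_zero, map_one]; exact (hgap 0).2.1.trans (hgap 0).1
    | succ n => exact (hgap n).2.1
  have hy : A.valuation y < 1 := by simpa using hxy 0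
  have hx0 : x ≠ 0 := by
    intro h
    simpa [h] using hxy 1
  have h₁ := hpro 1 le_rfl one_le_two ![x] (by simp [hx0, hx]) (by
    intro i j hij
    exact absurd hij (by simp [Subsingleton.elim i j]))
  have h₂ := hpro 2 one_le_two le_rfl ![x, y] (by simp [Fin.forall_fin_two, hx0, hx, hy0, hy]) (by
    simp [Fin.forall_fin_two, muchSmaller_of_gap hxy])
  have hcongr : ∀ S T : Set K, S = T →
      HasHenselianCoarsening (A.comap (algebraMap (relAlgClosure S) K)) →
      HasHenselianCoarsening (A.comap (algebraMap (relAlgClosure T) K)) := by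
    rintro S _ rfl h
    exact h
  replace h₁ := hcongr _ {x} (by simp) h₁
  replace h₂ := hcongr _ {x, y} (by simp [Set.pair_comm]) h₂
  obtain ⟨ψ, hψ, hiff⟩ := hQE 2 θ
  have hreal : ∀ w : Fin 2 → K, θ.Realize w ↔ ψ.Realize w := by
    have : K ⊨ macTheory A := inferInstanceAs (K ⊨ macLang.completeTheory K)
    intro w
    exact Theory.Iff.realize_iff hiff
  obtain ⟨M, hM, hM'⟩ := exists_realize_perturb hx hxy hy0 h₁ h₂ hψ rfl
  obtain ⟨N, hN⟩ := hM' M hM dvd_rfl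
  rw [hvxy, hreal] at hv
  have hw := (hN N le_rfl default).1 hv
  -- The formula of index `M * N` compares `y ^ (1 + M * N)` with the power of `x * y ^ M` of the
  -- same exponent `M * N + 1`; the latter has at least as large an additive value.
  have hbad := (realize_gapFormula (A := A) (M * N) _).1 (hcon _ ((hreal _).2 hw) (M * N))
  refine absurd hbad.2.1 (not_lt.2 ?_)
  change A.valuation ((x * y ^ M) ^ (M * N + 1)) ≤ A.valuation (y ^ (1 + M * N))
  rw [mul_pow, ← pow_mul, map_mul, map_pow, map_pow, map_pow]
  refine (mul_le_of_le_one_left' (pow_le_one' hx.le _)).trans (pow_le_pow_right_of_le_one' hy.le ?_)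
  rw [add_comm 1]
  exact Nat.le_mul_of_pos_left _ hM

/-! ### Rank one from omission of the gap type -/

/-- Properness of the valuation ring is first-order. It is needed because rank one excludes the
trivial value group. -/
theorem ne_top_of_macEquiv {L : Type*} [Field L] {B : ValuationSubring L} (h : MacEquiv B A)
    (hA : A ≠ ⊤) : B ≠ ⊤ := by
  let _ := macStructure A
  let _ := macStructure B
  let φ : macLang.Sentence := BoundedFormula.all
    (Relations.boundedFormula₁ (L := macLang) (MacRel.valRing : macLang.Relations 1)
      (Term.var (Sum.inr 0)) : macLang.BoundedFormula Empty 1)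
  have hφA : K ⊨ φ ↔ ∀ x, x ∈ A := Iff.rfl
  have hφB : L ⊨ φ ↔ ∀ x, x ∈ B := Iff.rfl
  have hAB : L ⊨ φ ↔ K ⊨ φ := elementarilyEquivalent_iff.1 h φ
  rintro rfl
  exact hA (eq_top_iff.2 fun x _ => hφA.1 (hAB.1 (hφB.2 fun _ => trivial)) x)

/-- Omission says that the powers of any `b > 1` are cofinal in the value group, so a convex
subgroup containing such a `b` is everything. -/
theorem rankOne_of_not_realizesGapType (hA : A ≠ ⊤)
    (h : ∀ x y : K, ¬ RealizesGapType A x y) : RankOne A := by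
  intro H
  constructor
  · rintro ⟨hconv, hH⟩
    rw [eq_bot_iff]
    by_contra! hne
    obtain ⟨b, hb, hb1⟩ : ∃ b ∈ H, 1 < b := by
      obtain ⟨b, hb, hb1⟩ := SetLike.not_le_iff_exists.1 hne
      rcases lt_or_gt_of_ne (show b ≠ 1 from hb1) with hlt | hgt
      · exact ⟨b⁻¹, H.inv_mem hb, one_lt_inv'.2 hlt⟩
      · exact ⟨b, hb, hgt⟩
    have key : ∀ g : A.ValueGroupˣ, 1 ≤ g → g ∈ H := by
      intro g hg
      -- Inverses are taken because elements of the maximal ideal have multiplicative value below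
      -- `1`.
      obtain ⟨x, hx⟩ := A.valuation_surjective ((b⁻¹ : A.ValueGroupˣ) : A.ValueGroup)
      obtain ⟨y, hy⟩ := A.valuation_surjective ((g⁻¹ : A.ValueGroupˣ) : A.ValueGroup)
      have hy0 : y ≠ 0 := (Valuation.ne_zero_iff A.valuation).1 (hy ▸ Units.ne_zero _)
      obtain ⟨n, hn, hlt⟩ : ∃ n : ℕ, 1 ≤ n ∧ A.valuation (x ^ n) ≤ A.valuation y := by
        by_contra! hcon
        refine h x y fun n hn => ⟨?_, hcon n hn, hy0⟩
        rw [map_pow, hx]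
        exact pow_lt_one₀ zero_le (by exact_mod_cast inv_lt_one'.2 hb1) (by omega)
      rw [map_pow, hx, hy, ← Units.val_pow_eq_pow_val, Units.val_le_val, inv_pow, inv_le_inv_iff]
        at hlt
      exact hconv g (b ^ n) (H.pow_mem hb n) hg hlt
    refine hH (eq_top_iff.2 fun g _ => ?_)
    rcases le_total 1 g with hg | hg
    · exact key g hg
    · exact inv_inv g ▸ H.inv_mem (key g⁻¹ (one_le_inv'.2 hg))
  · rintro rfl
    refine ⟨fun a b hb ha hab => ?_, fun htop => hA (eq_top_iff.2 fun x _ => ?_)⟩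
    · rw [Subgroup.mem_bot] at hb ⊢
      exact le_antisymm (hb ▸ hab) ha
    · rw [← A.valuation_le_one_iff]
      rcases eq_or_ne x 0 with rfl | hx
      · simp
      · have : Units.mk0 (A.valuation x) ((Valuation.ne_zero_iff _).2 hx) ∈
          (⊥ : Subgroup A.ValueGroupˣ) := htop ▸ Subgroup.mem_top _
        rw [Subgroup.mem_bot] at this
        exact (congrArg Units.val this).le

end MacintyreVal

theorem mainTheorem7 {K : Type*} [Field K] (A : ValuationSubring K) (hA : A ≠ ⊤)
    (hres : CharZero (IsLocalRing.ResidueField A))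
    (hQE : MacintyreVal.AdmitsQE (MacintyreVal.macTheory A))
    (hpro : MacintyreVal.ProhenselianOfDegree A 2) :
    ∃ (L : Type) (_ : Field L) (B : ValuationSubring L),
      MacintyreVal.RankOne B ∧ MacintyreVal.MacEquiv B A ∧
        ∀ x y : L, ¬ MacintyreVal.RealizesGapType B x y := by
  obtain ⟨L, _, B, hBA, hB⟩ := MacintyreVal.exists_macEquiv_omitting (A := A)
    MacintyreVal.gapFormula (MacintyreVal.exists_realize_not_gapFormula hQE hpro)
  have hgap : ∀ x y : L, ¬ MacintyreVal.RealizesGapType B x y := fun x y h => by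
    obtain ⟨k, hk⟩ := hB x y
    exact hk ((MacintyreVal.realizesGapType_iff x y).1 h k)
  exact ⟨L, _, B, MacintyreVal.rankOne_of_not_realizesGapType
    (MacintyreVal.ne_top_of_macEquiv hBA hA) hgap, hBA, hgap⟩
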